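/- Let $d\ge 1$ and let $K\subset\mathbb R^d$ be a $d$-dimensional convex polytope, i.e. the convex hull of finitely many points, with affine hull $\mathbb R^d$. Faces of $K$ are the intersections of $K$ with its supporting hyperplanes; let $V$ be the set of vertices ($0$-dimensional faces) and $F$ the set of facets ($(d-1)$-dimensional nonempty faces) of $K$; in particular, distinct facets lie in distinct hyperplanes ($K$ is non-degenerate). For $v\in V$ let $F_v=\{f\in F: v\in f\}$, and assume that $K$ is simple: $|F_v|=d$ for all $v\in V$. For $f\in F$ let $n_f$ be the unit outward normal vector on $f$ and, for $x\in K$, let $h_f(x)$ be the distance from $x$ to the hyperplane containing $f$. Let $h_K$ be the diameter of $K$ and $$h_*=\min\{h_f(v): f\in F,\ v\in V,\ v\notin f\}.$$ For $v\in V$ let $M_v$ be the $d\times d$ matrix whose columns are the vectors $n_f$, $f\in F_v$, in any order, and define the Wachspress coordinates on $K$ by $$\phi_v(x)=\frac{w_v(x)}{\sum_{u\in V}w_u(x)},\qquad w_v(x)=|\det M_v|\prod_{f\in F\setminus F_v}h_f(x),\qquad x\in K.$$ Then each $\phi_v$ is infinitely differentiable on $K$ (up to the boundary), and for every multi-index $\alpha\in\mathbb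 N_0^d$ there is a constant $C=C(|F|,|V|,\alpha,d)>0$, depending only on $|F|$, $|V|$, $\alpha$ and $d$, such that for all such $K$, all $v\in V$ and all $x\in K$ $$\left|D^{\alpha}\phi_v(x)\right|\le C\sum_{\substack{0\le\beta\le\alpha\\ |\alpha-\beta|\le |F|-d}}\ \ \sum_{\min\{|\beta|,1\}\le\lambda\le|\beta|}\frac{h_K^{|F|(1+\lambda)-|\alpha|}}{h_*^{|F|(1+\lambda)}},$$ where $\beta\in\mathbb N_0^d$ and $\lambda\in\mathbb N_0$, $|\alpha|=\sum_i\alpha_i$, $\beta\le\alpha$ is meant componentwise, and $D^\alpha=\partial^{|\alpha|}/\partial x_1^{\alpha_1}\cdots\partial x_d^{\alpha_d}$. -/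

import Mathlib

open scoped ContDiff

namespace Wachspress

noncomputable section

/-- A convex polytope: the convex hull of finitely many points. -/
def IsConvexPolytope {d : ℕ} (K : Set (EuclideanSpace ℝ (Fin d))) : Prop :=
  ∃ S : Finset (EuclideanSpace ℝ (Fin d)), K = convexHull ℝ (S : Set (EuclideanSpace ℝ (Fin d)))

/-- The vertices of `K`: the points `v` such that `{v}` is the intersection of `K` with one of its
supporting hyperplanes. -/
def vertices {d : ℕ} (K : Set (EuclideanSpace ℝ (Fin d))) : Set (EuclideanSpace ℝ (Fin d)) :=
  K.exposedPoints ℝ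

/-- The facets of `K`: the faces of dimension `d - 1`. A nonempty face is a nonempty exposed subset,
that is, the set of maximizers over `K` of some linear functional; its dimension is that of its
affine hull. Two different facets never lie in the same hyperplane. -/
def facets {d : ℕ} (K : Set (EuclideanSpace ℝ (Fin d))) : Set (Set (EuclideanSpace ℝ (Fin d))) :=
  {f | IsExposed ℝ K f ∧ f.Nonempty ∧ Module.finrank ℝ (vectorSpan ℝ f) + 1 = d}

/-- The set `F_v` of the facets of `K` that are incident to `v`. -/
def facetsAt {d : ℕ} (K : Set (EuclideanSpace ℝ (Fin d))) (v : EuclideanSpace ℝ (Fin d)) :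
    Set (Set (EuclideanSpace ℝ (Fin d))) :=
  {f | f ∈ facets K ∧ v ∈ f}

/-- A `d`-dimensional convex polytope in `ℝ^d` that is simple: each vertex is incident to exactly
`d` facets. -/
structure IsSimplePolytope {d : ℕ} (K : Set (EuclideanSpace ℝ (Fin d))) : Prop where
  isConvexPolytope : IsConvexPolytope K
  affineSpan_eq_top : affineSpan ℝ K = ⊤
  ncard_facetsAt : ∀ v ∈ vertices K, (facetsAt K v).ncard = d

/-- The distance `h_f(x)` from `x` to the hyperplane containing the facet `f`. -/
def facetDist {d : ℕ} (f : Set (EuclideanSpace ℝ (Fin d))) (x : EuclideanSpace ℝ (Fin d)) : ℝ :=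
  Metric.infDist x (affineSpan ℝ f : Set (EuclideanSpace ℝ (Fin d)))

/-- `h_*`: the minimal distance between a vertex and (the hyperplane containing) a facet that is
not incident to it. -/
def hStar {d : ℕ} (K : Set (EuclideanSpace ℝ (Fin d))) : ℝ :=
  sInf {r | ∃ f ∈ facets K, ∃ v ∈ vertices K, v ∉ f ∧ r = facetDist f v}

/-- `n` is a unit normal vector on `f ⊆ K` that points out of `K`. (If `x, y ∈ f`, then the
inequality holds both for `y - x` and for `x - y`, so `n` is orthogonal to `f`.) -/
def IsUnitOutwardNormal {d : ℕ} (K f : Set (EuclideanSpace ℝ (Fin d)))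
    (n : EuclideanSpace ℝ (Fin d)) : Prop :=
  ‖n‖ = 1 ∧ ∀ x ∈ f, ∀ y ∈ K, inner ℝ n (y - x) ≤ 0

/-- The unit outward normal vector `n_f`; it exists and is unique for a facet of a
`d`-dimensional polytope. -/
def outwardNormal {d : ℕ} (K f : Set (EuclideanSpace ℝ (Fin d))) : EuclideanSpace ℝ (Fin d) :=
  Classical.epsilon (IsUnitOutwardNormal K f)

/-- The matrix `[n_{f_1}, …, n_{f_d}]`, whose columns are the unit outward normals of the facets
incident to `v`, in the order given by `e`. -/
def normalMatrix {d : ℕ} (K : Set (EuclideanSpace ℝ (Fin d))) (v : EuclideanSpace ℝ (Fin d))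
    (e : Fin d ≃ facetsAt K v) : Matrix (Fin d) (Fin d) ℝ :=
  Matrix.of fun i j => outwardNormal K (e j : Set (EuclideanSpace ℝ (Fin d))) i

open Classical in
/-- The positive determinant `det M_v` of the matrix of the unit outward normals of the `d` facets
incident to `v`: the absolute value of the determinant for an arbitrary order of the facets. -/
def detNormals {d : ℕ} (K : Set (EuclideanSpace ℝ (Fin d))) (v : EuclideanSpace ℝ (Fin d)) : ℝ :=
  if h : Nonempty (Fin d ≃ facetsAt K v) then |(normalMatrix K v h.some).det| else 0

/-- The order of the facets does not matter. -/
theorem detNormals_eq {d : ℕ} (K : Set (EuclideanSpace ℝ (Fin d))) (v : EuclideanSpace ℝ (Fin d))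
    (e : Fin d ≃ facetsAt K v) : detNormals K v = |(normalMatrix K v e).det| := by
  have h : Nonempty (Fin d ≃ facetsAt K v) := ⟨e⟩
  have key : normalMatrix K v h.some
      = (normalMatrix K v e).submatrix id (h.some.trans e.symm) := by
    ext i j
    simp [normalMatrix]
  rw [detNormals, dif_pos h, key, Matrix.det_permute', abs_mul]
  simp [← Int.cast_abs]

/-- The weight `w_v(x) = det(M_v) ∏_{f ∈ F \ F_v} h_f(x)`. -/
def weight {d : ℕ} (K : Set (EuclideanSpace ℝ (Fin d))) (v x : EuclideanSpace ℝ (Fin d)) : ℝ :=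
  detNormals K v * ∏ᶠ f ∈ facets K \ facetsAt K v, facetDist f x

/-- The Wachspress coordinate `φ_v(x) = w_v(x) / ∑_{u ∈ V} w_u(x)`, for `x ∈ K`. -/
def coord {d : ℕ} (K : Set (EuclideanSpace ℝ (Fin d))) (v x : EuclideanSpace ℝ (Fin d)) : ℝ :=
  weight K v x / ∑ᶠ u ∈ vertices K, weight K u x

/-- The order `|α|` of a multi-index. -/
def order {d : ℕ} (α : Fin d → ℕ) : ℕ := ∑ i, α i

/-- The list in which each `i : Fin d` occurs `α i` times. -/
def directions {d : ℕ} (α : Fin d → ℕ) : List (Fin d) :=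
  (List.finRange d).flatMap fun i => List.replicate (α i) i

theorem length_directions {d : ℕ} (α : Fin d → ℕ) : (directions α).length = order α := by
  simp [directions, order, List.length_flatMap, List.sum_ofFn, ← List.ofFn_eq_map]

/-- The partial derivative `D^α g` at `x ∈ K` of a function `g` on the (closed) set `K`: the
derivative of order `|α|` of `g` within `K`, evaluated at `α i` copies of the `i`-th standard basis
vector for each `i`. It depends only on the values of `g` on `K`. -/
def partialDeriv {d : ℕ} (K : Set (EuclideanSpace ℝ (Fin d))) (α : Fin d → ℕ)
    (g : EuclideanSpace ℝ (Fin d) → ℝ) (x : EuclideanSpace ℝ (Fin d)) : ℝ :=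
  iteratedFDerivWithin ℝ (directions α).length g K x
    fun j => EuclideanSpace.single ((directions α).get j) (1 : ℝ)

end

end Wachspress

/-!
Write `H` for the diameter of `K` and `h` for `hStar K`. The summand with `β = α` and `λ = |α|`
occurs on the right-hand side (`div_pow_le_sum`), so it is enough to bound the derivatives of order
`m` of a Wachspress coordinate by a constant times `(H / h) ^ (|F| * (1 + m)) / H ^ m`.

On `K` each distance `h_f` is an affine function with slope at most `1` and values at most `H`.
By the Leibniz rule the weights, each a product of `|F| - d` of these functions and a determinant
that is at most `d!`, and their sum `W` have derivatives of order `i` bounded by `A / H ^ i`, where `A` is a constant times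
`H ^ (|F| - d)`. If `δ` is a lower bound for `W` on `K`, then the chain rule for `1 / W`
(`DerivBound.inv`) and the Leibniz rule bound the derivatives of order `m` of `w_v / W` by a
constant times `(A / δ) ^ (m + 1) / H ^ m`. What remains is that `δ` can be taken to be a constant
times `h ^ |F| / H ^ d`.

* Let `x ∈ K` be a convex combination of the vertices. One vertex `u` has coefficient at least
  `1 / |V|`, and since the `h_f` are affine and nonnegative, `h_f x ≥ h / |V|` for each facet `f`
  that avoids `u`. Hence `w_u x ≥ |det M_u| (h / |V|) ^ (|F| - d)` (`exists_le_weight`).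
* For each facet at `u` there is a vertex that is on all other facets at `u` but not on this one
  (`exists_adjacent_vertex`). If `E` is the matrix of the differences of these vertices and `u`,
  then `M_uᵀ E` is diagonal with entries of absolute value at least `h`, while `|det E| ≤ d! H ^ d`.
  Hence `|det M_u| ≥ h ^ d / (d! H ^ d)` (`hStar_pow_le`).

The adjacent vertices exist because the `d` facets at `u` are the only constraints on `K` near `u`.
This uses that a polytope is the intersection of the half-spaces of its facets
(`exists_facet_of_notMem`).
-/

namespace Wachspress

variable {d : ℕ} {K f : Set (EuclideanSpace ℝ (Fin d))} {v x y : EuclideanSpace ℝ (Fin d)}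

/-! ### Convex polytopes -/

theorem IsConvexPolytope.isCompact (hK : IsConvexPolytope K) : IsCompact K := by
  obtain ⟨S, rfl⟩ := hK
  exact S.finite_toSet.isCompact_convexHull ℝ

theorem IsConvexPolytope.convex (hK : IsConvexPolytope K) : Convex ℝ K := by
  obtain ⟨S, rfl⟩ := hK
  exact convex_convexHull ℝ _

theorem IsConvexPolytope.finite_extremePoints (hK : IsConvexPolytope K) :
    (K.extremePoints ℝ).Finite := by
  obtain ⟨S, rfl⟩ := hK
  exact S.finite_toSet.subset extremePoints_convexHull_subset

/-- An extreme point `v` of `convexHull S` with `S` finite is not in the compact set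
`convexHull (S \ {v})`, and a functional that separates the two exposes `v`. -/
theorem IsConvexPolytope.vertices_eq_extremePoints (hK : IsConvexPolytope K) :
    vertices K = K.extremePoints ℝ := by
  refine Set.Subset.antisymm exposedPoints_subset_extremePoints fun v hv => ?_
  have hvK := hv.1
  have hconv := hK.convex
  obtain ⟨S, rfl⟩ := hK
  have hv' := (hconv.mem_extremePoints_iff_mem_sdiff_convexHull_sdiff.1 hv).2
  have hnot : v ∉ convexHull ℝ ((S : Set (EuclideanSpace ℝ (Fin d))) \ {v}) := fun h =>
    hv' (convexHull_mono (Set.sdiff_subset_sdiff_left (subset_convexHull ℝ _)) h)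
  obtain ⟨l, c, hlc, hcv⟩ := geometric_hahn_banach_closed_point (convex_convexHull ℝ _)
    ((S.finite_toSet.subset Set.sdiff_subset).isCompact_convexHull ℝ).isClosed hnot
  have hC : Convex ℝ {y | l y < l v ∨ y = v} := by
    rintro y hy z hz a b ha hb hab
    have hyle : l y ≤ l v := hy.elim le_of_lt fun h => h ▸ le_rfl
    have hzle : l z ≤ l v := hz.elim le_of_lt fun h => h ▸ le_rfl
    simp only [Set.mem_ofPred_eq, map_add, map_smul, smul_eq_mul]
    rcases ha.eq_or_lt with rfl | ha
    · obtain rfl : b = 1 := by linarith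
      simpa using hz
    rcases hb.eq_or_lt with rfl | hb
    · obtain rfl : a = 1 := by linarith
      simpa using hy
    have hsplit : l v = a * l v + b * l v := by rw [← add_mul, hab, one_mul]
    rcases hy with hy | rfl
    · left; nlinarith
    rcases hz with hz | rfl
    · left; nlinarith
    · right; rw [← add_smul, hab, one_smul]
  have hsub : convexHull ℝ (S : Set (EuclideanSpace ℝ (Fin d))) ⊆ {y | l y < l v ∨ y = v} := by
    refine convexHull_min (fun y hy => ?_) hC
    by_cases hyv : y = v
    · exact Or.inr hyv
    · exact Or.inl ((hlc y (subset_convexHull ℝ _ ⟨hy, hyv⟩)).trans hcv)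
  refine ⟨hvK, l, fun y hy => ?_⟩
  rcases hsub hy with h | rfl
  · exact ⟨h.le, fun h' => absurd h h'.not_gt⟩
  · exact ⟨le_rfl, fun _ => rfl⟩

theorem IsConvexPolytope.finite_vertices (hK : IsConvexPolytope K) : (vertices K).Finite :=
  hK.vertices_eq_extremePoints ▸ hK.finite_extremePoints

theorem IsConvexPolytope.convexHull_vertices (hK : IsConvexPolytope K) :
    convexHull ℝ (vertices K) = K := by
  rw [← (hK.finite_vertices.isCompact_convexHull ℝ).isClosed.closure_eq,
    hK.vertices_eq_extremePoints, closure_convexHull_extremePoints hK.isCompact hK.convex]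

theorem vertices_subset : vertices K ⊆ K := fun _ h => h.1

/-- An exposed face is the closed convex hull of the extreme points of `K` that it contains. -/
theorem IsConvexPolytope.finite_isExposed (hK : IsConvexPolytope K) :
    {f | IsExposed ℝ K f}.Finite := by
  refine Set.Finite.of_injOn (f := fun f => f ∩ K.extremePoints ℝ)
    (t := 𝒫 (K.extremePoints ℝ)) (fun f _ => Set.inter_subset_right) ?_
    hK.finite_extremePoints.powerset
  intro f hf g hg hfg
  simp only at hfg
  rw [← hf.isExtreme.extremePoints_eq, ← hg.isExtreme.extremePoints_eq] at hfg
  rw [← closure_convexHull_extremePoints (hf.isCompact hK.isCompact) (hf.convex hK.convex),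
    ← closure_convexHull_extremePoints (hg.isCompact hK.isCompact) (hg.convex hK.convex), hfg]

theorem IsConvexPolytope.finite_facets (hK : IsConvexPolytope K) : (facets K).Finite :=
  hK.finite_isExposed.subset fun _ h => h.1

theorem IsConvexPolytope.interior_nonempty (hK : IsConvexPolytope K)
    (hspan : affineSpan ℝ K = ⊤) : (interior K).Nonempty :=
  hK.convex.interior_nonempty_iff_affineSpan_eq_top.2 hspan

/-- A point of `K` is a convex combination of the vertices, with coefficients `c`. -/
theorem IsConvexPolytope.exists_weights (hK : IsConvexPolytope K) (hx : x ∈ K) :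
    ∃ c : EuclideanSpace ℝ (Fin d) → ℝ,
      (∀ u ∈ hK.finite_vertices.toFinset, 0 ≤ c u) ∧ ∑ u ∈ hK.finite_vertices.toFinset, c u = 1 ∧
        ∑ u ∈ hK.finite_vertices.toFinset, c u • u = x := by
  rw [← hK.convexHull_vertices] at hx
  exact Finset.mem_convexHull'.1 (by simpa using hx)

/-! ### Facets and their hyperplanes -/

theorem facets_subset (hf : f ∈ facets K) : f ⊆ K := hf.1.subset

/-- A facet is the set where a nonzero linear functional attains its maximum over `K`. -/
theorem exists_functional (hspan : affineSpan ℝ K = ⊤) (hf : f ∈ facets K) :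
    ∃ l : StrongDual ℝ (EuclideanSpace ℝ (Fin d)), l ≠ 0 ∧ f = {x ∈ K | ∀ y ∈ K, l y ≤ l x} := by
  obtain ⟨l, hl⟩ := hf.1 hf.2.1
  refine ⟨l, ?_, hl⟩
  rintro rfl
  have hfK : f = K := by simpa using hl
  have h := hf.2.2
  rw [hfK, ← direction_affineSpan, hspan, AffineSubspace.direction_top, finrank_top,
    finrank_euclideanSpace_fin] at h
  omega

theorem isUnitOutwardNormal_outwardNormal (hspan : affineSpan ℝ K = ⊤) (hf : f ∈ facets K) :
    IsUnitOutwardNormal K f (outwardNormal K f) := by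
  obtain ⟨l, hl0, hl⟩ := exists_functional hspan hf
  refine Classical.epsilon_spec (p := IsUnitOutwardNormal K f)
    ⟨‖l‖⁻¹ • (InnerProductSpace.toDual ℝ _).symm l, ?_, fun x hx y hy => ?_⟩
  · rw [norm_smul, LinearIsometryEquiv.norm_map, norm_inv, norm_norm,
      inv_mul_cancel₀ (norm_ne_zero_iff.2 hl0)]
  · rw [real_inner_smul_left, InnerProductSpace.toDual_symm_apply, map_sub]
    rw [hl] at hx
    exact mul_nonpos_of_nonneg_of_nonpos (by positivity) (sub_nonpos.2 (hx.2 y hy))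

theorem inner_outwardNormal_le (hspan : affineSpan ℝ K = ⊤) (hf : f ∈ facets K) (hx : x ∈ f)
    (hy : y ∈ K) : inner ℝ (outwardNormal K f) (y - x) ≤ 0 :=
  (isUnitOutwardNormal_outwardNormal hspan hf).2 x hx y hy

theorem inner_outwardNormal_eq_zero (hspan : affineSpan ℝ K = ⊤) (hf : f ∈ facets K) (hx : x ∈ f)
    (hy : y ∈ f) : inner ℝ (outwardNormal K f) (y - x) = 0 := by
  refine le_antisymm (inner_outwardNormal_le hspan hf hx (facets_subset hf hy)) ?_
  have h := inner_outwardNormal_le hspan hf hy (facets_subset hf hx)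
  rw [← neg_sub, inner_neg_right] at h
  linarith

/-- The affine hull of a facet is a hyperplane; both sides have dimension `d - 1`. -/
theorem vectorSpan_facet (hspan : affineSpan ℝ K = ⊤) (hf : f ∈ facets K) :
    vectorSpan ℝ f = (ℝ ∙ outwardNormal K f)ᗮ := by
  have hn := (isUnitOutwardNormal_outwardNormal hspan hf).1
  refine Submodule.eq_of_le_of_finrank_eq ?_ ?_
  · refine Submodule.span_le.2 ?_
    rintro _ ⟨y, hy, x, hx, rfl⟩
    exact Submodule.mem_orthogonal_singleton_iff_inner_right.2
      (inner_outwardNormal_eq_zero hspan hf hx hy)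
  · have h := Submodule.finrank_add_finrank_orthogonal (ℝ ∙ outwardNormal K f)
    rw [finrank_span_singleton (by rintro h; simp [h] at hn), finrank_euclideanSpace_fin] at h
    have := hf.2.2
    omega

theorem mem_affineSpan_facet (hspan : affineSpan ℝ K = ⊤) (hf : f ∈ facets K) (hx : x ∈ f) :
    y ∈ affineSpan ℝ f ↔ inner ℝ (outwardNormal K f) (y - x) = 0 := by
  rw [← Submodule.mem_orthogonal_singleton_iff_inner_right, ← vectorSpan_facet hspan hf,
    ← direction_affineSpan]
  exact (AffineSubspace.vsub_right_mem_direction_iff_mem (subset_affineSpan ℝ f hx) y).symm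

theorem facetDist_eq_abs (hspan : affineSpan ℝ K = ⊤) (hf : f ∈ facets K) (hx : x ∈ f)
    (y : EuclideanSpace ℝ (Fin d)) :
    facetDist f y = |inner ℝ (outwardNormal K f) (y - x)| := by
  have hn := (isUnitOutwardNormal_outwardNormal hspan hf).1
  have hnn : inner ℝ (outwardNormal K f) (outwardNormal K f) = (1 : ℝ) := by
    rw [real_inner_self_eq_norm_sq, hn, one_pow]
  refine le_antisymm ?_ ?_
  · -- the foot of the perpendicular from `y`
    set t : ℝ := inner ℝ (outwardNormal K f) (y - x) with ht
    have hmem : y - t • outwardNormal K f ∈ affineSpan ℝ f := by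
      rw [mem_affineSpan_facet hspan hf hx, sub_right_comm, inner_sub_right, inner_smul_right, hnn,
        ← ht]
      ring
    refine (Metric.infDist_le_dist_of_mem hmem).trans ?_
    rw [dist_eq_norm, sub_sub_cancel, norm_smul, hn, mul_one, Real.norm_eq_abs]
  · refine (Metric.le_infDist ⟨x, subset_affineSpan ℝ f hx⟩).2 fun z hz => ?_
    have hz0 := (mem_affineSpan_facet hspan hf hx).1 hz
    have hyz : inner ℝ (outwardNormal K f) (y - x) = inner ℝ (outwardNormal K f) (y - z) := by
      rw [← sub_add_sub_cancel y z x, inner_add_right, hz0, add_zero]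
    rw [hyz, dist_eq_norm]
    simpa [hn] using abs_real_inner_le_norm (outwardNormal K f) (y - z)

theorem facetDist_nonneg : 0 ≤ facetDist f x := Metric.infDist_nonneg

/-- On `K`, the distance to the hyperplane of a facet is an affine function. -/
theorem facetDist_eq (hspan : affineSpan ℝ K = ⊤) (hf : f ∈ facets K) (hx : x ∈ f) (hy : y ∈ K) :
    facetDist f y = inner ℝ (outwardNormal K f) (x - y) := by
  rw [facetDist_eq_abs hspan hf hx, abs_of_nonpos (inner_outwardNormal_le hspan hf hx hy),
    ← inner_neg_right, neg_sub]

theorem facetDist_eq_zero_iff (hspan : affineSpan ℝ K = ⊤) (hf : f ∈ facets K) (hy : y ∈ K) :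
    facetDist f y = 0 ↔ y ∈ f := by
  obtain ⟨x, hx⟩ := hf.2.1
  constructor
  · intro h
    rw [facetDist_eq_abs hspan hf hx, abs_eq_zero, ← mem_affineSpan_facet hspan hf hx] at h
    obtain ⟨l, -, hl⟩ := exists_functional hspan hf
    -- the functional that exposes `f` is constant on the affine hull of `f`
    have hly : l (y - x) = 0 := by
      have hle : vectorSpan ℝ f ≤ LinearMap.ker l.toLinearMap := by
        refine Submodule.span_le.2 ?_
        rintro _ ⟨a, ha, b, hb, rfl⟩
        rw [hl] at ha hb
        have := le_antisymm (ha.2 b hb.1) (hb.2 a ha.1)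
        simp [this]
      refine hle ?_
      rw [← direction_affineSpan]
      exact AffineSubspace.vsub_mem_direction h (subset_affineSpan ℝ f hx)
    rw [hl] at hx ⊢
    rw [map_sub, sub_eq_zero] at hly
    exact ⟨hy, fun z hz => hly ▸ hx.2 z hz⟩
  · intro h
    rw [facetDist_eq hspan hf h hy, sub_self, inner_zero_right]

theorem facetDist_le_diam (hK : IsConvexPolytope K) (hf : f ∈ facets K) (hy : y ∈ K) :
    facetDist f y ≤ Metric.diam K := by
  obtain ⟨x, hx⟩ := hf.2.1
  exact (Metric.infDist_le_dist_of_mem (subset_affineSpan ℝ f hx)).trans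
    (Metric.dist_le_diam_of_mem hK.isCompact.isBounded hy (facets_subset hf hx))

theorem facetDist_sum (hK : IsConvexPolytope K) (hspan : affineSpan ℝ K = ⊤) (hf : f ∈ facets K)
    (hx : x ∈ K) {c : EuclideanSpace ℝ (Fin d) → ℝ}
    (hc : ∑ u ∈ hK.finite_vertices.toFinset, c u = 1)
    (hcx : ∑ u ∈ hK.finite_vertices.toFinset, c u • u = x) :
    facetDist f x = ∑ u ∈ hK.finite_vertices.toFinset, c u * facetDist f u := by
  obtain ⟨p, hp⟩ := hf.2.1
  have h : ∀ u ∈ hK.finite_vertices.toFinset,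
      c u * facetDist f u = inner ℝ (outwardNormal K f) (c u • p - c u • u) := fun u hu => by
    rw [facetDist_eq hspan hf hp (vertices_subset (by simpa using hu)), ← smul_sub,
      inner_smul_right]
  rw [Finset.sum_congr rfl h, ← inner_sum, Finset.sum_sub_distrib, ← Finset.sum_smul, hc, hcx,
    one_smul, facetDist_eq hspan hf hp hx]

/-! ### A polytope is cut out by its facets -/

/-- Finitely many proper affine subspaces form a null set, which does not contain the interior of
`K`. -/
theorem exists_mem_interior_notMem_affineSpan (hK : IsConvexPolytope K)
    (hspan : affineSpan ℝ K = ⊤) (x : EuclideanSpace ℝ (Fin d)) :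
    ∃ y ∈ interior K, ∀ g, IsExposed ℝ K g → affineSpan ℝ (insert x g) ≠ ⊤ →
      y ∉ affineSpan ℝ (insert x g) := by
  have hpos : 0 < MeasureTheory.volume (interior K) :=
    isOpen_interior.measure_pos _ (hK.interior_nonempty hspan)
  have hfin : {g | IsExposed ℝ K g ∧ affineSpan ℝ (insert x g) ≠ ⊤}.Finite :=
    hK.finite_isExposed.subset fun _ h => h.1
  have hnull : MeasureTheory.volume (⋃ g ∈ {g | IsExposed ℝ K g ∧ affineSpan ℝ (insert x g) ≠ ⊤},
      (affineSpan ℝ (insert x g) : Set (EuclideanSpace ℝ (Fin d)))) = 0 :=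
    (MeasureTheory.measure_biUnion_null_iff hfin.countable).2 fun g hg =>
      MeasureTheory.Measure.addHaar_affineSubspace _ _ hg.2
  obtain ⟨y, hy, hy'⟩ : (interior K \ ⋃ g ∈ {g | IsExposed ℝ K g ∧ affineSpan ℝ (insert x g) ≠ ⊤},
      (affineSpan ℝ (insert x g) : Set (EuclideanSpace ℝ (Fin d)))).Nonempty := by
    rw [Set.nonempty_iff_ne_empty]
    intro h
    exact hpos.ne' (MeasureTheory.measure_mono_null (Set.sdiff_eq_empty.1 h) hnull)
  refine ⟨y, hy, fun g hg hg' hmem => hy' ?_⟩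
  exact Set.mem_biUnion (show g ∈ {g | IsExposed ℝ K g ∧ affineSpan ℝ (insert x g) ≠ ⊤} from
    ⟨hg, hg'⟩) hmem

/-- A point outside a polytope violates the inequality of some facet. The segment to the point from
a generic interior point leaves the polytope through the relative interior of a facet: an exposed
face `g` of smaller dimension spans together with the point a proper affine subspace, which the
generic point avoids. -/
theorem exists_facet_of_notMem (hK : IsConvexPolytope K) (hspan : affineSpan ℝ K = ⊤)
    (hx : x ∉ K) : ∃ f ∈ facets K, ∃ p ∈ f, 0 < inner ℝ (outwardNormal K f) (x - p) := by
  obtain ⟨y, hy, hgen⟩ := exists_mem_interior_notMem_affineSpan hK hspan x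
  have hclosed := hK.isCompact.isClosed
  obtain ⟨p, hpseg, hpK, hpint⟩ : ∃ p ∈ segment ℝ y x, p ∈ K ∧ p ∉ interior K := by
    by_contra! hcon
    obtain ⟨z, -, hz, hz'⟩ := (convex_segment y x).isPreconnected (interior K) Kᶜ isOpen_interior
      hclosed.isOpen_compl (fun z hz => by
        by_cases hzK : z ∈ K
        · exact Or.inl (hcon z hz hzK)
        · exact Or.inr hzK) ⟨y, left_mem_segment ℝ y x, hy⟩ ⟨x, right_mem_segment ℝ y x, hx⟩
    exact hz' (interior_subset hz)
  obtain ⟨a, b, ha, hb, hab, rfl⟩ := hpseg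
  have ha0 : 0 < a := ha.lt_of_ne' fun h => hx (by
    obtain rfl : b = 1 := by linarith
    simpa [h] using hpK)
  have hb0 : 0 < b := hb.lt_of_ne' fun h => hpint (by
    obtain rfl : a = 1 := by linarith
    simpa [h] using hy)
  set p := a • y + b • x with hp
  obtain ⟨l, hl⟩ := geometric_hahn_banach_open_point hK.convex.interior isOpen_interior hpint
  have hlK : ∀ z ∈ K, l z ≤ l p := fun z hz => by
    have hz' : z ∈ closure (interior K) := by
      rw [hK.convex.closure_interior_eq_closure_of_nonempty_interior ⟨y, hy⟩]
      exact subset_closure hz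
    exact closure_minimal (fun w hw => (hl w hw).le)
      (isClosed_le l.continuous continuous_const) hz'
  have hg : IsExposed ℝ K (l.toExposed K) := ContinuousLinearMap.toExposed.isExposed
  have hpg : p ∈ l.toExposed K := ⟨hpK, hlK⟩
  -- `y` is on the line through `x` and `p`
  have hyspan : y ∈ affineSpan ℝ (insert x (l.toExposed K)) := by
    have hline := AffineMap.lineMap_mem (k := ℝ) (a⁻¹ : ℝ)
      (subset_affineSpan ℝ (insert x (l.toExposed K)) (Set.mem_insert x _))
      (subset_affineSpan ℝ _ (Set.mem_insert_of_mem x hpg))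
    convert hline using 1
    rw [AffineMap.lineMap_apply, vsub_eq_sub, vadd_eq_add, hp]
    have hb' : b = 1 - a := by linarith
    rw [hb']
    match_scalars <;> field_simp
    ring
  have htop : affineSpan ℝ (insert x (l.toExposed K)) = ⊤ := by
    by_contra h
    exact hgen _ hg h hyspan
  have hfacet : l.toExposed K ∈ facets K := by
    refine ⟨hg, ⟨p, hpg⟩, le_antisymm ?_ ?_⟩
    · have hlt : vectorSpan ℝ (l.toExposed K) < ⊤ := by
        refine lt_of_le_of_lt (b := LinearMap.ker l.toLinearMap) ?_ ?_
        · refine Submodule.span_le.2 ?_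
          rintro _ ⟨z, hz, w, hw, rfl⟩
          have := le_antisymm (hw.2 z hz.1) (hz.2 w hw.1)
          simp [this]
        · refine lt_top_iff_ne_top.2 fun h => (hl y hy).ne ?_
          have h0 : l.toLinearMap = 0 := LinearMap.ker_eq_top.1 h
          have h1 : ∀ z, l z = 0 := fun z => LinearMap.congr_fun h0 z
          rw [h1, h1]
      have h := Submodule.finrank_lt hlt.ne
      rw [finrank_euclideanSpace_fin] at h
      omega
    · have h := finrank_vectorSpan_insert_le (affineSpan ℝ (l.toExposed K)) x
      rw [← direction_affineSpan, affineSpan_insert_affineSpan, htop,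
        AffineSubspace.direction_top, finrank_top, finrank_euclideanSpace_fin,
        direction_affineSpan] at h
      exact h
  refine ⟨_, hfacet, p, hpg, ?_⟩
  have hyp : inner ℝ (outwardNormal K (l.toExposed K)) (y - p) < 0 := by
    refine (inner_outwardNormal_le hspan hfacet hpg (interior_subset hy)).lt_of_ne fun h => ?_
    have h0 : y ∈ l.toExposed K := by
      rw [← facetDist_eq_zero_iff hspan hfacet (interior_subset hy),
        facetDist_eq_abs hspan hfacet hpg, h, abs_zero]
    exact (hl y hy).not_ge (h0.2 p hpK)
  have hxp : x - p = (-(a / b)) • (y - p) := by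
    rw [hp]
    have ha' : a = 1 - b := by linarith
    rw [ha']
    match_scalars <;> field_simp
    ring
  rw [hxp, inner_smul_right]
  exact mul_pos_of_neg_of_neg (neg_lt_zero.2 (div_pos ha0 hb0)) hyp

/-- Near a point `v` of `K` only the facets at `v` bound the polytope. -/
theorem exists_pos_add_smul_mem (hK : IsConvexPolytope K) (hspan : affineSpan ℝ K = ⊤)
    (hv : v ∈ K) (hy : ∀ f ∈ facetsAt K v, inner ℝ (outwardNormal K f) y ≤ 0) :
    ∃ ε : ℝ, 0 < ε ∧ v + ε • y ∈ K := by
  have hev : ∀ᶠ ε : ℝ in nhdsWithin 0 (Set.Ioi 0), ∀ f ∈ facets K, ∀ p ∈ f,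
      inner ℝ (outwardNormal K f) (v + ε • y - p) ≤ 0 := by
    rw [Filter.eventually_all_finite hK.finite_facets]
    intro f hf
    obtain ⟨q, hq⟩ := hf.2.1
    have hqp : ∀ z, ∀ p ∈ f, inner ℝ (outwardNormal K f) (z - p)
        = (inner ℝ (outwardNormal K f) (z - q) : ℝ) := fun z p hp => by
      rw [← sub_add_sub_cancel z q p, inner_add_right, inner_outwardNormal_eq_zero hspan hf hp hq,
        add_zero]
    by_cases hvf : v ∈ f
    · filter_upwards [self_mem_nhdsWithin] with ε hε p hp
      rw [hqp _ p hp, ← hqp _ v hvf, add_sub_cancel_left, inner_smul_right]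
      exact mul_nonpos_of_nonneg_of_nonpos (le_of_lt hε) (hy f ⟨hf, hvf⟩)
    · have hlt : inner ℝ (outwardNormal K f) (v - q) < 0 := by
        refine (inner_outwardNormal_le hspan hf hq hv).lt_of_ne fun h => hvf ?_
        rw [← facetDist_eq_zero_iff hspan hf hv, facetDist_eq_abs hspan hf hq, h, abs_zero]
      have hcont : Continuous fun ε : ℝ =>
          (inner ℝ (outwardNormal K f) (v + ε • y - q) : ℝ) := by fun_prop
      have h0 : ∀ᶠ ε : ℝ in nhds 0, inner ℝ (outwardNormal K f) (v + ε • y - q) < (0 : ℝ) :=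
        hcont.continuousAt.eventually (gt_mem_nhds (by simpa using hlt))
      filter_upwards [nhdsWithin_le_nhds h0] with ε hε p hp
      rw [hqp _ p hp]
      exact hε.le
  obtain ⟨ε, hε, hpos⟩ := (hev.and self_mem_nhdsWithin).exists
  refine ⟨ε, hpos, ?_⟩
  by_contra hmem
  obtain ⟨f, hf, p, hp, h⟩ := exists_facet_of_notMem hK hspan hmem
  exact h.not_ge (hε f hf p hp)

/-- The normals of the facets at a vertex span the space: along a direction orthogonal to all of
them `K` would contain a segment around the vertex. -/
theorem eq_zero_of_inner_outwardNormal_eq_zero (hK : IsConvexPolytope K)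
    (hspan : affineSpan ℝ K = ⊤) (hv : v ∈ vertices K)
    (hy : ∀ f ∈ facetsAt K v, inner ℝ (outwardNormal K f) y = (0 : ℝ)) : y = 0 := by
  obtain ⟨ε, hε, h1⟩ := exists_pos_add_smul_mem hK hspan (vertices_subset hv) fun f hf =>
    (hy f hf).le
  obtain ⟨η, hη, h2⟩ := exists_pos_add_smul_mem (y := -y) hK hspan (vertices_subset hv)
    fun f hf => by rw [inner_neg_right, hy f hf, neg_zero]
  rw [hK.vertices_eq_extremePoints] at hv
  have h := hv.2 h1 h2 ⟨η / (ε + η), ε / (ε + η), by positivity, by positivity, by field_simp; ring,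
    by match_scalars <;> field_simp <;> ring⟩
  simpa [hε.ne'] using h

theorem IsSimplePolytope.nonempty_equiv (hK : IsSimplePolytope K) (hv : v ∈ vertices K) :
    Nonempty (Fin d ≃ facetsAt K v) := by
  have hfin : (facetsAt K v).Finite := hK.isConvexPolytope.finite_facets.subset fun _ h => h.1
  have := hfin.to_subtype
  exact ⟨(Finite.equivFinOfCardEq (hK.ncard_facetsAt v hv)).symm⟩

theorem inner_eq_transpose_mulVec (e : Fin d ≃ facetsAt K v) (j : Fin d)
    (y : EuclideanSpace ℝ (Fin d)) :
    (inner ℝ (outwardNormal K (e j)) y : ℝ) =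
      ((normalMatrix K v e).transpose.mulVec (WithLp.ofLp y)) j := by
  simp [PiLp.inner_apply, normalMatrix, Matrix.mulVec, dotProduct, mul_comm]

theorem IsSimplePolytope.det_normalMatrix_ne_zero (hK : IsSimplePolytope K) (hv : v ∈ vertices K)
    (e : Fin d ≃ facetsAt K v) : (normalMatrix K v e).det ≠ 0 := by
  rw [← Matrix.det_transpose]
  intro h
  obtain ⟨w, hw, hw0⟩ := Matrix.exists_mulVec_eq_zero_iff.2 h
  refine hw ?_
  have h0 := eq_zero_of_inner_outwardNormal_eq_zero (y := WithLp.toLp 2 w) hK.isConvexPolytope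
    hK.affineSpan_eq_top hv fun f hf => by
      have := inner_eq_transpose_mulVec e (e.symm ⟨f, hf⟩) (WithLp.toLp 2 w)
      simpa [hw0] using this
  simpa using congrArg WithLp.ofLp h0

/-- The vertex at the other end of the edge that leaves `v` along all facets at `v` but one. -/
theorem IsSimplePolytope.exists_adjacent_vertex (hK : IsSimplePolytope K) (hv : v ∈ vertices K)
    (e : Fin d ≃ facetsAt K v) (i : Fin d) :
    ∃ u ∈ vertices K, u ∉ (e i : Set (EuclideanSpace ℝ (Fin d))) ∧
      ∀ j, j ≠ i → u ∈ (e j : Set (EuclideanSpace ℝ (Fin d))) := by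
  have hP := hK.isConvexPolytope
  have hspan := hK.affineSpan_eq_top
  have hunit : IsUnit (normalMatrix K v e).transpose := by
    rw [Matrix.isUnit_iff_isUnit_det, Matrix.det_transpose]
    exact (hK.det_normalMatrix_ne_zero hv e).isUnit
  obtain ⟨w, hw⟩ := (Matrix.mulVec_surjective_iff_isUnit.2 hunit) (-Pi.single i 1)
  have hin : ∀ j, (inner ℝ (outwardNormal K (e j)) (WithLp.toLp 2 w) : ℝ) =
      (-Pi.single i 1 : Fin d → ℝ) j := fun j => by
    rw [inner_eq_transpose_mulVec]
    exact congrFun hw j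
  obtain ⟨ε, hε, hmem⟩ := exists_pos_add_smul_mem (y := WithLp.toLp 2 w) hP hspan
    (vertices_subset hv) fun f hf => by
      have h := hin (e.symm ⟨f, hf⟩)
      rw [Equiv.apply_symm_apply] at h
      rw [h, Pi.neg_apply, neg_nonpos]
      rw [Pi.single_apply]
      split_ifs <;> norm_num
  have hdist : ∀ j, facetDist (e j : Set (EuclideanSpace ℝ (Fin d))) (v + ε • WithLp.toLp 2 w) =
      ε * (Pi.single i 1 : Fin d → ℝ) j := fun j => by
    rw [facetDist_eq hspan (e j).2.1 (e j).2.2 hmem, sub_add_cancel_left, inner_neg_right,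
      inner_smul_right, hin, Pi.neg_apply]
    ring
  obtain ⟨c, hc0, hc1, hcx⟩ := hP.exists_weights hmem
  have hsum := fun j => facetDist_sum hP hspan (e j).2.1 hmem hc1 hcx
  -- some vertex of positive weight is off the facet `e i`
  obtain ⟨u, hu, hne⟩ : ∃ u ∈ hP.finite_vertices.toFinset,
      c u * facetDist (e i : Set (EuclideanSpace ℝ (Fin d))) u ≠ 0 := by
    refine Finset.exists_ne_zero_of_sum_ne_zero ?_
    rw [← hsum i, hdist]
    simpa using hε.ne'
  have hu' : u ∈ vertices K := by simpa using hu
  refine ⟨u, hu', fun h => hne ?_, fun j hj => ?_⟩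
  · rw [(facetDist_eq_zero_iff hspan (e i).2.1 (vertices_subset hu')).2 h, mul_zero]
  · have h0 := hsum j
    rw [hdist, Pi.single_eq_of_ne hj, mul_zero] at h0
    have := (Finset.sum_eq_zero_iff_of_nonneg fun z hz =>
      mul_nonneg (hc0 z hz) facetDist_nonneg).1 h0.symm u hu
    rw [← facetDist_eq_zero_iff hspan (e j).2.1 (vertices_subset hu')]
    exact (mul_eq_zero.1 this).resolve_left (left_ne_zero_of_mul hne)

/-! ### Lower bounds for the weights -/

theorem hStar_le (hf : f ∈ facets K) (hv : v ∈ vertices K) (hvf : v ∉ f) :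
    hStar K ≤ facetDist f v :=
  csInf_le ⟨0, by rintro _ ⟨f, -, v, -, -, rfl⟩; exact facetDist_nonneg⟩ ⟨f, hf, v, hv, hvf, rfl⟩

theorem hStar_nonneg : 0 ≤ hStar K :=
  Real.sInf_nonneg (by rintro _ ⟨f, -, v, -, -, rfl⟩; exact facetDist_nonneg)

theorem IsSimplePolytope.hStar_pos (hK : IsSimplePolytope K) (hd : 1 ≤ d) (hv : v ∈ vertices K) :
    0 < hStar K := by
  have hP := hK.isConvexPolytope
  obtain ⟨e⟩ := hK.nonempty_equiv hv
  obtain ⟨u, hu, huf, -⟩ := hK.exists_adjacent_vertex hv e ⟨0, hd⟩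
  have hfin : {r | ∃ f ∈ facets K, ∃ v ∈ vertices K, v ∉ f ∧ r = facetDist f v}.Finite := by
    refine ((hP.finite_facets.prod hP.finite_vertices).image fun p => facetDist p.1 p.2).subset ?_
    rintro _ ⟨f, hf, v, hv, -, rfl⟩
    exact ⟨(f, v), ⟨hf, hv⟩, rfl⟩
  obtain ⟨f, hf, w, hw, hwf, h⟩ := Set.Nonempty.csInf_mem
    (show {r | ∃ f ∈ facets K, ∃ v ∈ vertices K, v ∉ f ∧ r = facetDist f v}.Nonempty from
      ⟨_, _, (e ⟨0, hd⟩).2.1, u, hu, huf, rfl⟩) hfin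
  rw [hStar, h]
  refine facetDist_nonneg.lt_of_ne' fun h0 => hwf ?_
  exact (facetDist_eq_zero_iff hK.affineSpan_eq_top hf (vertices_subset hw)).1 h0

/-- With `E` the matrix of the edges `u_i - v`, the matrix `M_vᵀ E` is diagonal with entries
`-h_i(u_i)`, while `|det E| ≤ d! h_K^d`. -/
theorem IsSimplePolytope.hStar_pow_le (hK : IsSimplePolytope K) (hv : v ∈ vertices K) :
    hStar K ^ d ≤ detNormals K v * (d.factorial * Metric.diam K ^ d) := by
  have hP := hK.isConvexPolytope
  obtain ⟨e⟩ := hK.nonempty_equiv hv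
  rw [detNormals_eq K v e]
  choose u hu hui huj using hK.exists_adjacent_vertex hv e
  let A : Matrix (Fin d) (Fin d) ℝ := Matrix.of fun k i => (u i - v) k
  have hentry : ∀ i j, ((normalMatrix K v e).transpose * A) j i =
      inner ℝ (outwardNormal K (e j)) (u i - v) := fun i j => by
    rw [inner_eq_transpose_mulVec]
    rfl
  have hdiag : (normalMatrix K v e).transpose * A =
      Matrix.diagonal fun i => -facetDist (e i : Set (EuclideanSpace ℝ (Fin d))) (u i) := by
    ext j i
    rw [hentry]
    rcases eq_or_ne j i with rfl | hji
    · rw [Matrix.diagonal_apply_eq, facetDist_eq hK.affineSpan_eq_top (e j).2.1 (e j).2.2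
        (vertices_subset (hu j)), ← inner_neg_right, neg_sub]
    · rw [Matrix.diagonal_apply_ne _ hji]
      exact inner_outwardNormal_eq_zero hK.affineSpan_eq_top (e j).2.1 (e j).2.2 (huj i j hji)
  have hdet := congrArg (fun B => |Matrix.det B|) hdiag
  simp only [Matrix.det_mul, Matrix.det_transpose, Matrix.det_diagonal, abs_mul, Finset.abs_prod,
    abs_neg, abs_of_nonneg facetDist_nonneg] at hdet
  have hA : |A.det| ≤ d.factorial * Metric.diam K ^ d := by
    have h := Matrix.det_le (A := A) (abv := AbsoluteValue.abs) (x := Metric.diam K) fun k i => by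
      refine (PiLp.norm_apply_le (u i - v) k).trans ?_
      rw [← dist_eq_norm]
      exact Metric.dist_le_diam_of_mem hP.isCompact.isBounded (vertices_subset (hu i))
        (vertices_subset hv)
    simpa using h
  calc hStar K ^ d = ∏ _i : Fin d, hStar K := by simp
    _ ≤ ∏ i, facetDist (e i : Set (EuclideanSpace ℝ (Fin d))) (u i) :=
        Finset.prod_le_prod (fun _ _ => hStar_nonneg) fun i _ => hStar_le (e i).2.1 (hu i) (hui i)
    _ = |(normalMatrix K v e).det| * |A.det| := hdet.symm
    _ ≤ _ := by gcongr

theorem detNormals_nonneg : 0 ≤ detNormals K v := by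
  rw [detNormals]
  split_ifs <;> positivity

theorem IsSimplePolytope.detNormals_le (hK : IsSimplePolytope K) (hv : v ∈ vertices K) :
    detNormals K v ≤ d.factorial := by
  obtain ⟨e⟩ := hK.nonempty_equiv hv
  rw [detNormals_eq K v e]
  have h := Matrix.det_le (A := normalMatrix K v e) (abv := AbsoluteValue.abs) (x := 1)
    fun i j => by
      refine (PiLp.norm_apply_le (outwardNormal K (e j)) i).trans ?_
      rw [(isUnitOutwardNormal_outwardNormal hK.affineSpan_eq_top (e j).2.1).1]
  simpa using h

theorem IsSimplePolytope.card_compl_facetsAt (hK : IsSimplePolytope K) (hv : v ∈ vertices K)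
    (hfin : (facets K \ facetsAt K v).Finite) :
    hfin.toFinset.card + d = (facets K).ncard := by
  rw [← Set.ncard_eq_toFinset_card _ hfin]
  have h := Set.ncard_sdiff_add_ncard_of_subset (s := facetsAt K v) (fun _ h => h.1)
    hK.isConvexPolytope.finite_facets
  rwa [hK.ncard_facetsAt v hv] at h

theorem weight_nonneg : 0 ≤ weight K v x :=
  mul_nonneg detNormals_nonneg (finprod_nonneg fun _ => finprod_nonneg fun _ => facetDist_nonneg)

/-- A vertex that has weight at least `1 / |V|` in a convex combination representing `x` is a good
one: all facets that avoid this vertex are at distance at least `h_* / |V|` from `x`. -/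
theorem IsSimplePolytope.exists_le_weight (hK : IsSimplePolytope K) (hx : x ∈ K) :
    ∃ u ∈ vertices K, detNormals K u *
      (hStar K / (vertices K).ncard) ^ ((facets K).ncard - d) ≤ weight K u x := by
  have hP := hK.isConvexPolytope
  obtain ⟨c, hc0, hc1, hcx⟩ := hP.exists_weights hx
  have hcard : hP.finite_vertices.toFinset.card = (vertices K).ncard :=
    (Set.ncard_eq_toFinset_card _ hP.finite_vertices).symm
  have hne : hP.finite_vertices.toFinset.Nonempty := by
    rw [Finset.nonempty_iff_ne_empty]
    intro h
    simp [h] at hc1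
  obtain ⟨u, hu, hcu⟩ := Finset.exists_le_of_sum_le (f := fun _ => ((vertices K).ncard : ℝ)⁻¹)
    (g := c) hne (by
      rw [hc1, Finset.sum_const, nsmul_eq_mul, hcard, mul_inv_cancel₀]
      rw [← hcard]
      exact_mod_cast hne.card_pos.ne')
  have hu' : u ∈ vertices K := by simpa using hu
  have hfin : (facets K \ facetsAt K u).Finite := hP.finite_facets.sdiff
  refine ⟨u, hu', ?_⟩
  rw [weight, finprod_mem_eq_finite_toFinset_prod _ hfin, ← hK.card_compl_facetsAt hu' hfin,
    Nat.add_sub_cancel, ← Finset.prod_const]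
  refine mul_le_mul_of_nonneg_left (Finset.prod_le_prod
    (fun _ _ => div_nonneg hStar_nonneg (Nat.cast_nonneg _)) fun f hf => ?_) detNormals_nonneg
  have hf' : f ∈ facets K \ facetsAt K u := by simpa using hf
  rw [facetDist_sum hP hK.affineSpan_eq_top hf'.1 hx hc1 hcx]
  refine le_trans ?_ (Finset.single_le_sum (f := fun z => c z * facetDist f z)
    (fun z hz => mul_nonneg (hc0 z hz) facetDist_nonneg) hu)
  rw [div_eq_inv_mul]
  exact mul_le_mul hcu (hStar_le hf'.1 hu' fun h => hf'.2 ⟨hf'.1, h⟩) hStar_nonneg (hc0 u hu)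

/-! ### Scale-invariant bounds for derivatives -/

section DerivBound

variable {E : Type*} [NormedAddCommGroup E] [NormedSpace ℝ E] {s : Set E} {H A B : ℝ} {n : ℕ}
  {u w : E → ℝ}

/-- `u` is smooth on `s`, and its derivatives of each order `i ≤ n` are bounded on `s` by
`A / H ^ i`. Here `H` is the length scale of `s`. The derivatives are taken within `s`, so that
only the values of `u` on `s` matter. -/
structure DerivBound (s : Set E) (H : ℝ) (n : ℕ) (A : ℝ) (u : E → ℝ) : Prop where
  contDiffOn : ContDiffOn ℝ ∞ u s
  norm_le : ∀ x ∈ s, ∀ i ≤ n, ‖iteratedFDerivWithin ℝ i u s x‖ ≤ A / H ^ i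

theorem DerivBound.congr (h : DerivBound s H n A u) (hw : ∀ x ∈ s, w x = u x) :
    DerivBound s H n A w :=
  ⟨h.contDiffOn.congr hw, fun x hx i hi => by
    rw [iteratedFDerivWithin_congr hw hx]
    exact h.norm_le x hx i hi⟩

theorem DerivBound.mono (hH : 0 ≤ H) (h : DerivBound s H n A u) (hAB : A ≤ B) :
    DerivBound s H n B u :=
  ⟨h.contDiffOn, fun x hx i hi => (h.norm_le x hx i hi).trans (by gcongr)⟩

theorem derivBound_one (hH : 0 ≤ H) : DerivBound s H n 1 (fun _ => 1) := by
  refine ⟨contDiffOn_const, fun x _ i _ => ?_⟩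
  rcases i with _ | i
  · simp
  · rw [iteratedFDerivWithin_succ_const, Pi.zero_apply, norm_zero]
    positivity

theorem DerivBound.const_mul (hs : UniqueDiffOn ℝ s) (h : DerivBound s H n A u) (c : ℝ) :
    DerivBound s H n (|c| * A) (fun x => c * u x) := by
  refine ⟨contDiffOn_const.mul h.contDiffOn, fun x hx i hi => ?_⟩
  have hc : iteratedFDerivWithin ℝ i (fun x => c * u x) s x =
      c • iteratedFDerivWithin ℝ i u s x :=
    iteratedFDerivWithin_const_smul_apply (a := c) (i := i)
      ((h.contDiffOn x hx).of_le (mod_cast le_top)) hs hx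
  rw [hc, norm_smul, Real.norm_eq_abs, mul_div_assoc]
  exact mul_le_mul_of_nonneg_left (h.norm_le x hx i hi) (abs_nonneg c)

theorem DerivBound.mul (hs : UniqueDiffOn ℝ s) (hH : 0 < H) (hA : 0 ≤ A) (hB : 0 ≤ B)
    (hu : DerivBound s H n A u) (hw : DerivBound s H n B w) :
    DerivBound s H n (2 ^ n * (A * B)) (fun x => u x * w x) := by
  refine ⟨hu.contDiffOn.mul hw.contDiffOn, fun x hx i hi => ?_⟩
  refine (norm_iteratedFDerivWithin_mul_le hu.contDiffOn hw.contDiffOn hs hx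
    (n := i) (mod_cast le_top)).trans ?_
  calc _ ≤ ∑ k ∈ Finset.range (i + 1), (i.choose k : ℝ) * (A * B / H ^ i) := by
        refine Finset.sum_le_sum fun k hk => ?_
        have hki : k ≤ i := Nat.lt_succ_iff.1 (Finset.mem_range.1 hk)
        have hsplit : A * B / H ^ i = A / H ^ k * (B / H ^ (i - k)) := by
          rw [div_mul_div_comm, ← pow_add, Nat.add_sub_cancel' hki]
        rw [mul_assoc, hsplit]
        have h1 := hu.norm_le x hx k (hki.trans hi)
        have h2 := hw.norm_le x hx (i - k) ((Nat.sub_le i k).trans hi)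
        gcongr
    _ = 2 ^ i * (A * B) / H ^ i := by
        rw [← Finset.sum_mul, ← Nat.cast_sum, Nat.sum_range_choose]
        push_cast
        ring
    _ ≤ 2 ^ n * (A * B) / H ^ i := by
        gcongr
        norm_num

theorem derivBound_prod {ι : Type*} (t : Finset ι) {u : ι → E → ℝ} (hs : UniqueDiffOn ℝ s)
    (hH : 0 < H) (hA : 0 ≤ A) (hu : ∀ j ∈ t, DerivBound s H n A (u j)) :
    DerivBound s H n ((2 ^ n * A) ^ t.card) (fun x => ∏ j ∈ t, u j x) := by
  classical
  induction t using Finset.induction_on with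
  | empty => simpa using derivBound_one hH.le
  | insert j t hj ih =>
    have h := (hu j (Finset.mem_insert_self j t)).mul hs hH hA (by positivity)
      (ih fun k hk => hu k (Finset.mem_insert_of_mem hk))
    simp only [Finset.prod_insert hj, Finset.card_insert_of_notMem hj, pow_succ']
    rwa [mul_assoc]

theorem derivBound_sum {ι : Type*} (t : Finset ι) {u : ι → E → ℝ} (hs : UniqueDiffOn ℝ s)
    (hu : ∀ j ∈ t, DerivBound s H n A (u j)) :
    DerivBound s H n (t.card * A) (fun x => ∑ j ∈ t, u j x) := by
  refine ⟨ContDiffOn.sum fun j hj => (hu j hj).contDiffOn, fun x hx i hi => ?_⟩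
  rw [iteratedFDerivWithin_fun_sum_apply hs hx fun j hj =>
    ((hu j hj).contDiffOn x hx).of_le (mod_cast le_top)]
  refine (norm_sum_le_of_le t fun j hj => (hu j hj).norm_le x hx i hi).trans_eq ?_
  rw [Finset.sum_const, nsmul_eq_mul, mul_div_assoc]

/-- An affine function with slope at most `1` and values at most `H`. -/
theorem derivBound_affine (hs : UniqueDiffOn ℝ s) (hH : 0 < H) (L : E →L[ℝ] ℝ) (hL : ‖L‖ ≤ 1)
    (c : ℝ) (hle : ∀ x ∈ s, |c + L x| ≤ H) : DerivBound s H n H (fun x => c + L x) := by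
  refine ⟨contDiffOn_const.add L.contDiff.contDiffOn, fun x hx i _ => ?_⟩
  rcases i with _ | i
  · simpa using hle x hx
  have hderiv : ∀ y ∈ s, fderivWithin ℝ (fun x => c + L x) s y = (fun _ : E => L) y := fun y hy =>
    (L.hasFDerivWithinAt.const_add c).fderivWithin (hs y hy)
  rw [← norm_iteratedFDerivWithin_fderivWithin hs hx, iteratedFDerivWithin_congr hderiv hx]
  rcases i with _ | i
  · simpa [hH.ne'] using hL
  · rw [iteratedFDerivWithin_succ_const, Pi.zero_apply, norm_zero]
    positivity

theorem norm_iteratedFDerivWithin_inv_le {y : ℝ} (hy : 1 ≤ y) (i : ℕ) :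
    ‖iteratedFDerivWithin ℝ i (Inv.inv : ℝ → ℝ) (Set.Ioi 0) y‖ ≤ i.factorial := by
  have hy0 : (0 : ℝ) < y := one_pos.trans_le hy
  rw [iteratedFDerivWithin_of_isOpen i isOpen_Ioi hy0, norm_iteratedFDeriv_eq_norm_iteratedDeriv,
    iteratedDeriv_eq_iterate, iter_deriv_inv, norm_mul, norm_mul, norm_pow, norm_neg, norm_one,
    one_pow, one_mul, Real.norm_natCast, Real.norm_of_nonneg (zpow_nonneg hy0.le _)]
  exact mul_le_of_le_one_right (Nat.cast_nonneg _) (zpow_le_one_of_nonpos₀ hy (by omega))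

/-- The reciprocal of a function that is bounded below by `δ`: the chain rule for `u / δ ≥ 1` and
the inversion, whose derivatives on `[1, ∞)` are bounded by factorials. -/
theorem DerivBound.inv (hs : UniqueDiffOn ℝ s) (hH : 0 < H) {δ : ℝ} (hδ : 0 < δ) (hδA : δ ≤ A)
    (h : DerivBound s H n A u) (hu : ∀ x ∈ s, δ ≤ u x) :
    DerivBound s H n (δ⁻¹ * (n.factorial ^ 2 * (A / δ) ^ n)) (fun x => (u x)⁻¹) := by
  have hone : 1 ≤ A / δ := (one_le_div hδ).2 hδA
  have hscaled := h.const_mul hs δ⁻¹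
  have hge : ∀ x ∈ s, 1 ≤ δ⁻¹ * u x := fun x hx => by
    rw [← div_eq_inv_mul]
    exact (one_le_div hδ).2 (hu x hx)
  have hmaps : Set.MapsTo (fun x => δ⁻¹ * u x) s (Set.Ioi 0) := fun x hx =>
    one_pos.trans_le (hge x hx)
  have hinv : ContDiffOn ℝ ∞ (Inv.inv : ℝ → ℝ) (Set.Ioi 0) := fun y hy =>
    (contDiffAt_inv ℝ (ne_of_gt hy)).contDiffWithinAt
  have hcomp : DerivBound s H n (n.factorial ^ 2 * (A / δ) ^ n)
      (Inv.inv ∘ fun x => δ⁻¹ * u x) := by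
    refine ⟨hinv.comp hscaled.contDiffOn hmaps, fun x hx i hi => ?_⟩
    refine (norm_iteratedFDerivWithin_comp_le (n := i) (C := i.factorial) (D := A / δ / H) hinv
      hscaled.contDiffOn (mod_cast le_top) isOpen_Ioi.uniqueDiffOn hs hmaps hx (fun k hk =>
        (norm_iteratedFDerivWithin_inv_le (hge x hx) k).trans
          (mod_cast Nat.factorial_le hk)) fun k hk hki => ?_).trans ?_
    · refine (hscaled.norm_le x hx k (hki.trans hi)).trans ?_
      rw [abs_of_pos (inv_pos.2 hδ), ← div_eq_inv_mul, div_pow]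
      gcongr
      exact le_self_pow₀ hone (by omega)
    · rw [div_pow, ← mul_div_assoc, ← sq]
      gcongr
  have hfinal := hcomp.const_mul hs δ⁻¹
  rw [abs_of_pos (inv_pos.2 hδ)] at hfinal
  refine hfinal.congr fun x hx => ?_
  rw [Function.comp_apply, mul_inv, inv_inv, inv_mul_cancel_left₀ hδ.ne']

end DerivBound

/-! ### Bounds for the Wachspress coordinates -/

theorem derivBound_facetDist (hK : IsConvexPolytope K) (hspan : affineSpan ℝ K = ⊤)
    (hdiam : 0 < Metric.diam K) (hf : f ∈ facets K) (n : ℕ) :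
    DerivBound K (Metric.diam K) n (Metric.diam K) (facetDist f) := by
  obtain ⟨p, hp⟩ := hf.2.1
  have hs := uniqueDiffOn_convex hK.convex (hK.interior_nonempty hspan)
  have heq : ∀ y ∈ K, facetDist f y =
      inner ℝ (outwardNormal K f) p + (-innerSL ℝ (outwardNormal K f)) y := fun y hy => by
    rw [facetDist_eq hspan hf hp hy, inner_sub_right, sub_eq_add_neg]
    rfl
  refine (derivBound_affine hs hdiam _ ?_ _ fun y hy => ?_).congr heq
  · rw [norm_neg, innerSL_apply_norm, (isUnitOutwardNormal_outwardNormal hspan hf).1]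
  · rw [← heq y hy, abs_of_nonneg facetDist_nonneg]
    exact facetDist_le_diam hK hf hy

theorem IsSimplePolytope.derivBound_weight (hK : IsSimplePolytope K) (hdiam : 0 < Metric.diam K)
    (hv : v ∈ vertices K) (n : ℕ) :
    DerivBound K (Metric.diam K) n
      (d.factorial * (2 ^ n * Metric.diam K) ^ ((facets K).ncard - d)) (weight K v) := by
  have hP := hK.isConvexPolytope
  have hs := uniqueDiffOn_convex hP.convex (hP.interior_nonempty hK.affineSpan_eq_top)
  have hfin : (facets K \ facetsAt K v).Finite := hP.finite_facets.sdiff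
  have h := (derivBound_prod (n := n) hfin.toFinset (u := facetDist) hs hdiam hdiam.le
    fun f hf => derivBound_facetDist hP hK.affineSpan_eq_top hdiam
      ((hfin.mem_toFinset.1 hf).1) n).const_mul hs (detNormals K v)
  rw [abs_of_nonneg detNormals_nonneg] at h
  rw [← hK.card_compl_facetsAt hv hfin, Nat.add_sub_cancel]
  refine (h.mono hdiam.le ?_).congr fun x _ => ?_
  · gcongr
    exact hK.detNormals_le hv
  · rw [weight, finprod_mem_eq_finite_toFinset_prod _ hfin]

theorem IsSimplePolytope.le_ncard_facets (hK : IsSimplePolytope K) (hv : v ∈ vertices K) :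
    d ≤ (facets K).ncard :=
  (hK.ncard_facetsAt v hv).symm.trans_le
    (Set.ncard_le_ncard (fun _ h => h.1) hK.isConvexPolytope.finite_facets)

theorem IsSimplePolytope.diam_pos (hK : IsSimplePolytope K) (hd : 1 ≤ d) (hv : v ∈ vertices K) :
    0 < Metric.diam K := by
  obtain ⟨e⟩ := hK.nonempty_equiv hv
  obtain ⟨u, hu, huf, -⟩ := hK.exists_adjacent_vertex hv e ⟨0, hd⟩
  exact ((hK.hStar_pos hd hv).trans_le (hStar_le (e ⟨0, hd⟩).2.1 hu huf)).trans_le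
    (facetDist_le_diam hK.isConvexPolytope (e ⟨0, hd⟩).2.1 (vertices_subset hu))

theorem IsSimplePolytope.le_sum_weight (hK : IsSimplePolytope K) (hd : 1 ≤ d) (hx : x ∈ K) :
    hStar K ^ d / (d.factorial * Metric.diam K ^ d) *
        (hStar K / (vertices K).ncard) ^ ((facets K).ncard - d) ≤
      ∑ᶠ u ∈ vertices K, weight K u x := by
  have hfin := hK.isConvexPolytope.finite_vertices
  obtain ⟨u, hu, hle⟩ := hK.exists_le_weight hx
  have hdiam := hK.diam_pos hd hu
  rw [finsum_mem_eq_finite_toFinset_sum _ hfin]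
  refine le_trans ?_ (hle.trans (Finset.single_le_sum (f := fun u => weight K u x)
    (fun _ _ => weight_nonneg) (hfin.mem_toFinset.2 hu)))
  refine mul_le_mul_of_nonneg_right ?_
    (pow_nonneg (div_nonneg hStar_nonneg (Nat.cast_nonneg _)) _)
  exact (div_le_iff₀ (by positivity)).2 (hK.hStar_pow_le hu)

/-- The constant in the estimate for the derivatives of order `m`. -/
def coordConst (d m nF nV : ℕ) : ℝ :=
  2 ^ m * (m.factorial ^ 2 *
    (nV * d.factorial ^ 2 * (2 ^ m) ^ (nF - d) * nV ^ (nF - d)) ^ (m + 1))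

theorem IsSimplePolytope.derivBound_coord (hK : IsSimplePolytope K) (hd : 1 ≤ d)
    (hv : v ∈ vertices K) (m : ℕ) :
    DerivBound K (Metric.diam K) m
      (coordConst d m (facets K).ncard (vertices K).ncard *
        (Metric.diam K / hStar K) ^ ((facets K).ncard * (1 + m))) (coord K v) := by
  have hP := hK.isConvexPolytope
  have hs := uniqueDiffOn_convex hP.convex (hP.interior_nonempty hK.affineSpan_eq_top)
  have hdiam := hK.diam_pos hd hv
  have hstar := hK.hStar_pos hd hv
  have hfin := hP.finite_vertices
  have hcard : hfin.toFinset.card = (vertices K).ncard :=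
    (Set.ncard_eq_toFinset_card _ hfin).symm
  have hV : 1 ≤ (vertices K).ncard := (Set.ncard_pos hfin).2 ⟨v, hv⟩
  have hF := hK.le_ncard_facets hv
  have hsum := derivBound_sum hfin.toFinset hs fun u hu =>
    hK.derivBound_weight hdiam (hfin.mem_toFinset.1 hu) m
  have hlow := fun x (hx : x ∈ K) => hK.le_sum_weight hd hx
  simp only [finsum_mem_eq_finite_toFinset_sum _ hfin] at hlow
  rw [hcard] at hsum
  have hnum := hK.derivBound_weight hdiam hv m
  generalize hnV : (vertices K).ncard = nV at *
  generalize hnF : (facets K).ncard = nF at *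
  have hV' : (1 : ℝ) ≤ nV := by exact_mod_cast hV
  have hV0 : (0 : ℝ) < nV := one_pos.trans_le hV'
  set A : ℝ := nV * (d.factorial * (2 ^ m * Metric.diam K) ^ (nF - d)) with hA
  set δ : ℝ := hStar K ^ d / (d.factorial * Metric.diam K ^ d) * (hStar K / nV) ^ (nF - d) with hδ
  have hApos : 0 < A := by positivity
  have hδpos : 0 < δ := by positivity
  have hδA : δ ≤ A := by
    have h := hsum.norm_le v (vertices_subset hv) 0 (Nat.zero_le m)
    rw [norm_iteratedFDerivWithin_zero, pow_zero, div_one] at h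
    exact (hlow v (vertices_subset hv)).trans ((le_abs_self _).trans h)
  have hratio : A / δ = (nV * d.factorial ^ 2 * (2 ^ m) ^ (nF - d) * nV ^ (nF - d)) *
      (Metric.diam K / hStar K) ^ nF := by
    obtain ⟨k, rfl⟩ := Nat.exists_eq_add_of_le hF
    rw [hA, hδ, Nat.add_sub_cancel_left]
    simp only [div_pow, mul_pow, pow_add]
    field_simp
  have hquot := (hnum.mono hdiam.le (B := A) (le_mul_of_one_le_left (by positivity) hV')).mul hs
    hdiam hApos.le (by positivity) (hsum.inv hs hdiam hδpos hδA hlow)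
  refine (hquot.mono hdiam.le (le_of_eq ?_)).congr fun x _ => ?_
  · calc 2 ^ m * (A * (δ⁻¹ * (m.factorial ^ 2 * (A / δ) ^ m)))
        = 2 ^ m * (m.factorial ^ 2 * (A / δ) ^ (m + 1)) := by ring
      _ = _ := by
        rw [hratio, mul_pow _ (_ ^ nF), ← pow_mul, coordConst, add_comm 1 m]
        ring
  · rw [coord, finsum_mem_eq_finite_toFinset_sum _ hfin, div_eq_mul_inv]

theorem abs_partialDeriv_le (α : Fin d → ℕ) (g : EuclideanSpace ℝ (Fin d) → ℝ) :
    |partialDeriv K α g x| ≤ ‖iteratedFDerivWithin ℝ (order α) g K x‖ := by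
  rw [← length_directions, partialDeriv, ← Real.norm_eq_abs]
  refine (ContinuousMultilinearMap.le_opNorm _ _).trans_eq ?_
  simp

/-- The sum in the estimate is at least its summand with `β = α` and `λ = |α|`. -/
theorem div_pow_le_sum (α : Fin d → ℕ) {H h : ℝ} (hH : 0 < H) (hh : 0 < h) {nF : ℕ} (hF : d ≤ nF) :
    (H / h) ^ (nF * (1 + order α)) / H ^ order α ≤
      ∑ β ∈ (Finset.Icc 0 α).filter (fun β => order (α - β) + d ≤ nF),
        ∑ l ∈ Finset.Icc (min (order β) 1) (order β),
          H ^ ((nF : ℤ) * (1 + (l : ℤ)) - (order α : ℤ)) / h ^ (nF * (1 + l)) := by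
  have hα : α ∈ (Finset.Icc 0 α).filter (fun β => order (α - β) + d ≤ nF) := by
    simpa [order] using hF
  refine le_trans ?_ (Finset.single_le_sum (fun β _ => Finset.sum_nonneg fun l _ => ?_) hα)
  · refine le_trans (le_of_eq ?_) (Finset.single_le_sum
      (f := fun l : ℕ => H ^ ((nF : ℤ) * (1 + (l : ℤ)) - (order α : ℤ)) / h ^ (nF * (1 + l)))
      (fun l _ => ?_) (Finset.mem_Icc.2 ⟨min_le_left _ _, le_refl (order α)⟩))
    · have hexp : (nF : ℤ) * (1 + (order α : ℤ)) = ((nF * (1 + order α) : ℕ) : ℤ) := by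
        push_cast
        rfl
      simp only [hexp]
      rw [zpow_sub₀ hH.ne', zpow_natCast, zpow_natCast, div_pow]
      exact div_right_comm _ _ _
    · positivity
  · positivity

end Wachspress

theorem mainTheorem1 (d : ℕ) (hd : 1 ≤ d) (α : Fin d → ℕ) (nF nV : ℕ) :
    ∃ C : ℝ, 0 < C ∧
      ∀ K : Set (EuclideanSpace ℝ (Fin d)), Wachspress.IsSimplePolytope K →
        (Wachspress.facets K).ncard = nF → (Wachspress.vertices K).ncard = nV →
        ∀ v ∈ Wachspress.vertices K,
          ContDiffOn ℝ ∞ (Wachspress.coord K v) K ∧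
          ∀ x ∈ K,
            |Wachspress.partialDeriv K α (Wachspress.coord K v) x| ≤
              C * ∑ β ∈ (Finset.Icc 0 α).filter (fun β => Wachspress.order (α - β) + d ≤ nF),
                ∑ l ∈ Finset.Icc (min (Wachspress.order β) 1) (Wachspress.order β),
                  Metric.diam K ^ ((nF : ℤ) * (1 + (l : ℤ)) - (Wachspress.order α : ℤ)) /
                    Wachspress.hStar K ^ (nF * (1 + l)) := by
  have hnonneg : 0 ≤ Wachspress.coordConst d (Wachspress.order α) nF nV := by
    unfold Wachspress.coordConst
    positivity
  -- the summand `1` makes the constant positive also for `nV = 0`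
  refine ⟨Wachspress.coordConst d (Wachspress.order α) nF nV + 1, by positivity, ?_⟩
  rintro K hK rfl rfl v hv
  have hbound := hK.derivBound_coord hd hv (Wachspress.order α)
  have hdiam := hK.diam_pos hd hv
  have hstar := hK.hStar_pos hd hv
  refine ⟨hbound.contDiffOn, fun x hx => ?_⟩
  refine (Wachspress.abs_partialDeriv_le α _).trans ((hbound.norm_le x hx _ le_rfl).trans ?_)
  rw [mul_div_assoc]
  exact mul_le_mul (le_add_of_nonneg_right zero_le_one)
    (Wachspress.div_pow_le_sum α hdiam hstar (hK.le_ncard_facets hv)) (by positivity)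
    (by positivity)
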